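/- Let $d\ge 1$, let $\Omega\subset\mathbb{R}^d$ be a compact set of positive Lebesgue measure, and let $K:\Omega\times\Omega\to\mathbb{R}$ be continuous and symmetric, $K(p,q)=K(q,p)$. Let $L^2(\Omega)$ be the real Hilbert space of square-integrable functions with scalar product $\langle f,g\rangle_2=\int_\Omega f(p)g(p)\,dp$, and let $L_K:L^2(\Omega)\to L^2(\Omega)$, $(L_Kf)(p)=\int_\Omega K(p,q)f(q)\,dq$. Define the energy of $L_K$ by $\|L_K\|_2^2:=\int_\Omega\int_\Omega K(p,q)^2\,dq\,dp$. By an orthonormal eigensystem of $L_K$ we mean real numbers $(\lambda_n)_{n\ge0}$ and a complete orthonormal sequence $(\phi_n)_{n\ge0}$ of $L^2(\Omega)$ with $L_K\phi_n=\lambda_n\phi_n$ for all $n$. Then: (1) $L_K$ has an orthonormal eigensystem in which the nonzero eigenvalues are listed in order of nonincreasing absolute value: if $m\le n$ and $\lambda_m\ne0$, then $|\lambda_n|\le|\lambda_m|$. Moreover, for every orthonormal eigensystem $(\lambda_n,\phi_n)$ of $L_K$: (2) If $\lambda_n\neq0$, then $\phi_n$ has a representative, again written $\phi_n$, that is continuous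 on $\Omega$ and satisfies $\phi_n(p)=\lambda_n^{-1}\int_\Omega K(p,q)\phi_n(q)\,dq$ for every $p\in\Omega$. (3) $K(p,q)=\sum_n\lambda_n\phi_n(p)\phi_n(q)$, with unconditional convergence in $L^2(\Omega\times\Omega)$. If in addition $K$ is positive semidefinite on $\Omega$ (that is, $\sum_{i,j}c_ic_jK(p_i,p_j)\ge0$ for all finite families of points $p_i\in\Omega$ and reals $c_i$) and $|\Omega\cap B(p,r)|>0$ for all $p\in\Omega$ and $r>0$ (where $|\cdot|$ is Lebesgue measure and $B(p,r)$ the open ball), then, with the representatives of (2), the series converges to $K$ unconditionally and uniformly on $\Omega\times\Omega$. (4) For every $f\in L^2(\Omega)$, $L_Kf=\sum_n\lambda_n\langle f,\phi_n\rangle_2\,\phi_n$ with unconditional convergence in $L^2(\Omega)$. (5) For every $f\in L^2(\Omega)$, $$\|L_Kf\|_2^2=\sum_n\lambda_n^2\,|\langle f,\phi_n\rangle_2|^2\le\|f\|_2^2\sum_n\lambda_n^2 .$$ (6) $\sum_n\lambda_n^2$ converges and $\|L_K\|_2^2=\sum_n\lambda_n^2$; furthermore $\|L_K\|_2^2=\sum_n\|L_Kb_n\|_2^2$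 for every complete orthonormal sequence $(b_n)_{n\ge 0}$ of $L^2(\Omega)$. -/

import Mathlib

open MeasureTheory Set Filter Topology

namespace FTransform

/-- The measure underlying `L²(Ω)`: Lebesgue measure of `ℝ^d` restricted to `Ω`. -/
noncomputable abbrev mu {d : ℕ} (Ω : Set (EuclideanSpace ℝ (Fin d))) :
    Measure (EuclideanSpace ℝ (Fin d)) :=
  volume.restrict Ω

/-- The real Hilbert space `L²(Ω)`. -/
noncomputable abbrev L2 {d : ℕ} (Ω : Set (EuclideanSpace ℝ (Fin d))) : Type :=
  Lp ℝ 2 (mu Ω)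

/-- The function `p ↦ ∫_Ω K(p,q) f(q) dq`. -/
noncomputable def transform {d : ℕ} (Ω : Set (EuclideanSpace ℝ (Fin d)))
    (K : EuclideanSpace ℝ (Fin d) → EuclideanSpace ℝ (Fin d) → ℝ)
    (f : EuclideanSpace ℝ (Fin d) → ℝ) (p : EuclideanSpace ℝ (Fin d)) : ℝ :=
  ∫ q in Ω, K p q * f q

/-- The energy `‖L_K‖₂² = ‖K‖₂² = ∫_Ω ∫_Ω K(p,q)² dq dp` of the integral operator `L_K`, that is,
the squared norm of its kernel in `L²(Ω × Ω)`. -/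
noncomputable def energy {d : ℕ} (Ω : Set (EuclideanSpace ℝ (Fin d)))
    (K : EuclideanSpace ℝ (Fin d) → EuclideanSpace ℝ (Fin d) → ℝ) : ℝ :=
  ∫ p in Ω, ∫ q in Ω, K p q ^ 2

/-- The kernel is positive semidefinite on `Ω`: all its finite Gram matrices are. -/
def IsPosSemidefKernel {d : ℕ} (Ω : Set (EuclideanSpace ℝ (Fin d)))
    (K : EuclideanSpace ℝ (Fin d) → EuclideanSpace ℝ (Fin d) → ℝ) : Prop :=
  ∀ (m : ℕ) (p : Fin m → EuclideanSpace ℝ (Fin d)), (∀ i, p i ∈ Ω) →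
    ∀ c : Fin m → ℝ, 0 ≤ ∑ i, ∑ j, c i * c j * K (p i) (p j)

section Operator

variable {d : ℕ} {Ω : Set (EuclideanSpace ℝ (Fin d))}
  {K : EuclideanSpace ℝ (Fin d) → EuclideanSpace ℝ (Fin d) → ℝ}

theorem isFiniteMeasure_mu (hΩ : IsCompact Ω) : IsFiniteMeasure (mu Ω) :=
  ⟨by simpa [mu] using hΩ.measure_lt_top⟩

theorem exists_bound (hΩ : IsCompact Ω)
    (hK : ContinuousOn (fun z : EuclideanSpace ℝ (Fin d) × EuclideanSpace ℝ (Fin d) => K z.1 z.2)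
      (Ω ×ˢ Ω)) :
    ∃ C : ℝ, 0 ≤ C ∧ ∀ p ∈ Ω, ∀ q ∈ Ω, |K p q| ≤ C := by
  obtain ⟨C, hC⟩ := (hΩ.prod hΩ).exists_bound_of_continuousOn hK
  exact ⟨max C 0, le_max_right _ _, fun p hp q hq =>
    (hC (p, q) ⟨hp, hq⟩).trans (le_max_left _ _)⟩

theorem integrable_of_L2 (hΩ : IsCompact Ω) (f : L2 Ω) : Integrable f (mu Ω) := by
  have := isFiniteMeasure_mu hΩ
  exact (Lp.memLp f).integrable (by norm_num)

theorem aestronglyMeasurable_section (hΩ : IsCompact Ω)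
    (hK : ContinuousOn (fun z : EuclideanSpace ℝ (Fin d) × EuclideanSpace ℝ (Fin d) => K z.1 z.2)
      (Ω ×ˢ Ω)) {p : EuclideanSpace ℝ (Fin d)} (hp : p ∈ Ω) :
    AEStronglyMeasurable (K p) (mu Ω) := by
  refine ContinuousOn.aestronglyMeasurable ?_ hΩ.measurableSet
  exact hK.comp (f := fun q => (p, q)) (by fun_prop) (fun q hq => ⟨hp, hq⟩)

theorem integrable_section_mul (hΩ : IsCompact Ω)
    (hK : ContinuousOn (fun z : EuclideanSpace ℝ (Fin d) × EuclideanSpace ℝ (Fin d) => K z.1 z.2)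
      (Ω ×ˢ Ω)) {p : EuclideanSpace ℝ (Fin d)} (hp : p ∈ Ω) (f : L2 Ω) :
    Integrable (fun q => K p q * f q) (mu Ω) := by
  obtain ⟨C, -, hC⟩ := exists_bound hΩ hK
  refine (integrable_of_L2 hΩ f).bdd_mul (c := C) (aestronglyMeasurable_section hΩ hK hp) ?_
  filter_upwards [ae_restrict_mem hΩ.measurableSet] with q hq using hC p hp q hq

theorem continuousOn_transform (hΩ : IsCompact Ω)
    (hK : ContinuousOn (fun z : EuclideanSpace ℝ (Fin d) × EuclideanSpace ℝ (Fin d) => K z.1 z.2)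
      (Ω ×ˢ Ω)) (f : L2 Ω) : ContinuousOn (transform Ω K f) Ω := by
  obtain ⟨C, -, hC⟩ := exists_bound hΩ hK
  intro p hp
  refine MeasureTheory.continuousWithinAt_of_dominated (μ := mu Ω)
    (F := fun x q => K x q * f q) (bound := fun q => C * |f q|) ?_ ?_
    ((integrable_of_L2 hΩ f).abs.const_mul C) ?_
  · filter_upwards [self_mem_nhdsWithin] with x hx
    exact (integrable_section_mul hΩ hK hx f).aestronglyMeasurable
  · filter_upwards [self_mem_nhdsWithin] with x hx
    filter_upwards [ae_restrict_mem hΩ.measurableSet] with q hq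
    rw [norm_mul]
    exact mul_le_mul_of_nonneg_right (hC x hx q hq) (abs_nonneg _)
  · filter_upwards [ae_restrict_mem hΩ.measurableSet] with q hq
    refine ContinuousWithinAt.mul ?_ continuousWithinAt_const
    exact (hK.comp (f := fun x => (x, q)) (by fun_prop) (fun x hx => ⟨hx, hq⟩)) p hp

theorem exists_transform_bound (hΩ : IsCompact Ω)
    (hK : ContinuousOn (fun z : EuclideanSpace ℝ (Fin d) × EuclideanSpace ℝ (Fin d) => K z.1 z.2)
      (Ω ×ˢ Ω)) :
    ∃ C : ℝ, 0 ≤ C ∧ ∀ (f : L2 Ω), ∀ p ∈ Ω, |transform Ω K f p| ≤ C * ‖f‖ := by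
  have := isFiniteMeasure_mu hΩ
  obtain ⟨C, hC0, hC⟩ := exists_bound hΩ hK
  refine ⟨C * (mu Ω univ ^ (1 / 2 : ℝ)).toReal, by positivity, fun f p hp => ?_⟩
  have h1 : |transform Ω K f p| ≤ ∫ q in Ω, C * ‖f q‖ := by
    rw [← Real.norm_eq_abs, transform]
    refine norm_integral_le_of_norm_le ((integrable_of_L2 hΩ f).norm.const_mul C) ?_
    filter_upwards [ae_restrict_mem hΩ.measurableSet] with q hq
    rw [norm_mul]
    exact mul_le_mul_of_nonneg_right (hC p hp q hq) (norm_nonneg _)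
  have h2 : ∫ q in Ω, ‖f q‖ ≤ (mu Ω univ ^ (1 / 2 : ℝ)).toReal * ‖f‖ := by
    rw [integral_norm_eq_lintegral_enorm (integrable_of_L2 hΩ f).aestronglyMeasurable,
      ← eLpNorm_one_eq_lintegral_enorm, Lp.norm_def, mul_comm, ← ENNReal.toReal_mul]
    refine ENNReal.toReal_mono (ENNReal.mul_ne_top (Lp.eLpNorm_ne_top f) ?_) ?_
    · exact ENNReal.rpow_ne_top_of_nonneg (by norm_num) (measure_ne_top _ _)
    · have := eLpNorm_le_eLpNorm_mul_rpow_measure_univ (μ := mu Ω) (p := 1) (q := 2)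
        (by norm_num) (Lp.aestronglyMeasurable f)
      convert this using 3
      norm_num
  rw [integral_const_mul] at h1
  calc _ ≤ _ := h1
    _ ≤ C * ((mu Ω univ ^ (1 / 2 : ℝ)).toReal * ‖f‖) := mul_le_mul_of_nonneg_left h2 hC0
    _ = _ := by ring

theorem memLp_transform (hΩ : IsCompact Ω)
    (hK : ContinuousOn (fun z : EuclideanSpace ℝ (Fin d) × EuclideanSpace ℝ (Fin d) => K z.1 z.2)
      (Ω ×ˢ Ω)) (f : L2 Ω) : MemLp (transform Ω K f) 2 (mu Ω) := by
  have := isFiniteMeasure_mu hΩ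
  obtain ⟨C, -, hC⟩ := exists_transform_bound hΩ hK
  refine MemLp.of_bound
    ((continuousOn_transform hΩ hK f).aestronglyMeasurable hΩ.measurableSet) (C * ‖f‖) ?_
  filter_upwards [ae_restrict_mem hΩ.measurableSet] with p hp using hC f p hp

/-- The integral operator `L_K : L²(Ω) → L²(Ω)`, `(L_K f)(p) = ∫_Ω K(p,q) f(q) dq`, of a
continuous kernel on a compact set `Ω`, as a bounded linear operator. -/
noncomputable def integralOperator (hΩ : IsCompact Ω)
    (hK : ContinuousOn (fun z : EuclideanSpace ℝ (Fin d) × EuclideanSpace ℝ (Fin d) => K z.1 z.2)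
      (Ω ×ˢ Ω)) : L2 Ω →L[ℝ] L2 Ω :=
  LinearMap.mkContinuousOfExistsBound
    { toFun := fun f => (memLp_transform hΩ hK f).toLp (transform Ω K f)
      map_add' := by
        intro f g
        rw [← MemLp.toLp_add]
        refine (MemLp.toLp_eq_toLp_iff _ _).2 ?_
        filter_upwards [ae_restrict_mem hΩ.measurableSet] with p hp
        simp only [transform, Pi.add_apply]
        rw [← integral_add (integrable_section_mul hΩ hK hp f) (integrable_section_mul hΩ hK hp g)]
        refine integral_congr_ae ?_
        filter_upwards [Lp.coeFn_add f g] with q hq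
        rw [hq, Pi.add_apply, mul_add]
      map_smul' := by
        intro c f
        rw [RingHom.id_apply, ← MemLp.toLp_const_smul]
        refine (MemLp.toLp_eq_toLp_iff _ _).2 ?_
        filter_upwards [ae_restrict_mem hΩ.measurableSet] with p hp
        simp only [transform, Pi.smul_apply, smul_eq_mul]
        rw [← integral_const_mul]
        refine integral_congr_ae ?_
        filter_upwards [Lp.coeFn_smul c f] with q hq
        rw [hq, Pi.smul_apply, smul_eq_mul]
        ring }
    (by
      have := isFiniteMeasure_mu hΩ
      obtain ⟨C, hC0, hC⟩ := exists_transform_bound hΩ hK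
      refine ⟨(mu Ω).real univ ^ (2 : ENNReal).toReal⁻¹ * C, fun f => ?_⟩
      rw [mul_assoc]
      refine Lp.norm_le_of_ae_bound (by positivity) ?_
      filter_upwards [(memLp_transform hΩ hK f).coeFn_toLp,
        ae_restrict_mem hΩ.measurableSet] with p h1 hp
      exact (congrArg norm h1).trans_le (hC f p hp))

theorem integralOperator_ae (hΩ : IsCompact Ω)
    (hK : ContinuousOn (fun z : EuclideanSpace ℝ (Fin d) × EuclideanSpace ℝ (Fin d) => K z.1 z.2)
      (Ω ×ˢ Ω)) (f : L2 Ω) :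
    integralOperator hΩ hK f =ᵐ[mu Ω] fun p => ∫ q in Ω, K p q * f q :=
  (memLp_transform hΩ hK f).coeFn_toLp

end Operator

/-- `(lam n, e n)`, `n = 0, 1, 2, …`, is a (complete) orthonormal eigensystem of `T`. -/
def IsEigensystem {H : Type*} [NormedAddCommGroup H] [InnerProductSpace ℝ H] (T : H →L[ℝ] H)
    (lam : ℕ → ℝ) (e : HilbertBasis ℕ ℝ H) : Prop :=
  ∀ n, T (e n) = lam n • e n

end FTransform

/-!
The theorem combines the theory of compact symmetric operators with Mercer's theorem.

*Hilbert–Schmidt property.* For `p ∈ Ω` the section `K p` belongs to `L²(Ω)`, and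
`(L_K f)(p) = ⟪K p, f⟫`. Parseval's identity for `K p`, integrated over `p`, gives
`∑ ‖L_K (b i)‖² = ∫∫ K²` for every orthonormal basis `b`
(`FTransform.hasSum_norm_integralOperator_sq`). Hence `L_K` is a limit of finite sums of operators
of rank one, so it is compact (`HilbertBasis.isCompactOperator_of_summable`), and it is symmetric by
Fubini's theorem. The spectral theorem provides an orthonormal basis of eigenvectors; it is infinite
because Lebesgue measure has no atoms, and the square-summability of the eigenvalues allows listing
it in order of decreasing modulus (`HilbertBasis.exists_eigensystem_sorted`).

*Expansion in `L²(Ω × Ω)`.* Let `φ n` be the representative of `e n` that the eigenvalue equation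
provides (`FTransform.eigenfunction`). For almost every `p` the coefficients of `K p` are
`lam n * φ n p`. Bessel's identity for `K p`, integrated over `p`, shows that the squared distance from `K` to
the partial sum over `s` is `∫∫ K² - ∑ n ∈ s, (lam n)²`, which tends to zero
(`FTransform.IsEigensystem.eLpNorm_kernel_sub_sum`).

*Uniform expansion.* Let `K` be positive semidefinite and let `g` be its feature map into the
reproducing kernel Hilbert space, `⟪g p, g q⟫ = K p q`. The vectors `v n = ∫ e n (q) g(q) dq`
satisfy `⟪v m, v n⟫ = lam m * ⟪e m, e n⟫` and, if `lam n ≠ 0`, `⟪g p, v n⟫ = lam n * φ n p`. So the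
eigenvalues are squared norms, and the normalized nonzero `v n` form an orthonormal basis of the
feature space: the function `q ↦ ⟪w, g q⟫` of a vector `w` orthogonal to all of them is continuous
and orthogonal to all `e n`, hence zero, since the measure has full support in `Ω`. Parseval's
identity for `⟪g p, g q⟫` is the pointwise expansion of the kernel
(`FTransform.IsEigensystem.hasSum_kernel`). Dini's theorem on the diagonal and the inequality of
arithmetic and geometric means make it uniform
(`FTransform.IsEigensystem.tendstoUniformlyOn_kernel`).
-/

/-! ### Hilbert–Schmidt operators and the spectral theorem -/

section Hilbert

variable {ι H : Type*} [NormedAddCommGroup H] [InnerProductSpace ℝ H]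

theorem Orthonormal.countable_index [TopologicalSpace.SeparableSpace H] {v : ι → H}
    (hv : Orthonormal ℝ v) : Countable ι := by
  -- distinct members are at distance `√2`, so balls of radius `1 / 2` about them are disjoint
  have hdist : ∀ i j, i ≠ j → 1 ≤ dist (v i) (v j) := by
    intro i j hij
    have h : ‖v i - v j‖ ^ 2 = 2 := by
      rw [norm_sub_sq_real, hv.1, hv.1, hv.2 hij]; norm_num
    rw [dist_eq_norm]
    nlinarith [norm_nonneg (v i - v j)]
  rw [← Set.countable_univ_iff]
  refine Set.PairwiseDisjoint.countable_of_isOpen (s := fun i => Metric.ball (v i) (1 / 2))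
    (fun i _ j _ hij => ?_) (fun _ _ => Metric.isOpen_ball)
    (fun i _ => ⟨v i, Metric.mem_ball_self (by norm_num)⟩)
  exact Metric.ball_disjoint_ball (by linarith [hdist i j hij])

/-- A Hilbert–Schmidt operator is compact: the expansion `∑ i, ⟪b i, ·⟫ • T (b i)` into operators of
rank one converges to `T` in operator norm, by the Cauchy–Schwarz and Bessel inequalities. -/
theorem HilbertBasis.isCompactOperator_of_summable [CompleteSpace H] (b : HilbertBasis ι ℝ H)
    (T : H →L[ℝ] H) (hT : Summable fun i => ‖T (b i)‖ ^ 2) : IsCompactOperator T := by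
  set R : ι → H →L[ℝ] H := fun i => (innerSL ℝ (b i)).smulRight (T (b i)) with hR
  have hRapp : ∀ i x, R i x = inner ℝ (b i) x • T (b i) := fun i x => by simp [hR]
  have hbound : ∀ t : Finset ι, ‖∑ i ∈ t, R i‖ ≤ √(∑ i ∈ t, ‖T (b i)‖ ^ 2) := by
    intro t
    refine ContinuousLinearMap.opNorm_le_bound _ (Real.sqrt_nonneg _) fun x => ?_
    calc ‖(∑ i ∈ t, R i) x‖ = ‖∑ i ∈ t, inner ℝ (b i) x • T (b i)‖ := by
          simp [hRapp]
      _ ≤ ∑ i ∈ t, ‖T (b i)‖ * ‖inner ℝ (b i) x‖ := by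
          refine (norm_sum_le _ _).trans (Finset.sum_le_sum fun i _ => ?_)
          rw [norm_smul, mul_comm]
      _ ≤ √(∑ i ∈ t, ‖T (b i)‖ ^ 2) * √(∑ i ∈ t, ‖inner ℝ (b i) x‖ ^ 2) :=
          Real.sum_mul_le_sqrt_mul_sqrt _ _ _
      _ ≤ √(∑ i ∈ t, ‖T (b i)‖ ^ 2) * ‖x‖ := by
          refine mul_le_mul_of_nonneg_left ?_ (Real.sqrt_nonneg _)
          rw [Real.sqrt_le_left (norm_nonneg _)]
          exact b.orthonormal.sum_inner_products_le x
  have hsum : Summable R := by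
    rw [summable_iff_vanishing_norm]
    intro ε hε
    obtain ⟨s, hs⟩ := summable_iff_vanishing_norm.1 hT (ε ^ 2) (by positivity)
    refine ⟨s, fun t ht => (hbound t).trans_lt ?_⟩
    rw [Real.sqrt_lt' hε]
    exact (Real.le_norm_self _).trans_lt (hs t ht)
  have hS : HasSum R T := by
    convert hsum.hasSum
    refine ContinuousLinearMap.ext fun x => ?_
    have h1 := (ContinuousLinearMap.apply ℝ H x).hasSum hsum.hasSum
    have h2 := T.hasSum (b.hasSum_repr x)
    have h3 : (fun i => T (b.repr x i • b i)) = fun i => ContinuousLinearMap.apply ℝ H x (R i) := by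
      funext i
      simp [hRapp, b.repr_apply_apply]
    rw [h3] at h2
    exact h2.unique h1
  refine isCompactOperator_of_tendsto hS (Eventually.of_forall fun s => ?_)
  refine Submodule.sum_mem (compactOperator (RingHom.id ℝ) H H) fun i _ => ?_
  have h1 : IsCompactOperator (innerSL ℝ (b i)) :=
    isCompactOperator_of_locallyCompactSpace_dom (innerSL ℝ (b i))
  exact h1.clm_comp ((ContinuousLinearMap.id ℝ ℝ).smulRight (T (b i)))

/-- The spectral theorem for a compact symmetric operator, in terms of a basis: orthonormal bases
of the eigenspaces together form one of the whole space. -/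
theorem IsCompactOperator.exists_hilbertBasis_eigenvectors.{u} {H : Type u}
    [NormedAddCommGroup H] [InnerProductSpace ℝ H] [CompleteSpace H] {T : H →L[ℝ] H}
    (hT : IsCompactOperator T) (hsymm : (T : H →ₗ[ℝ] H).IsSymmetric) :
    ∃ (κ : Type u) (b : HilbertBasis κ ℝ H) (lam : κ → ℝ), ∀ i, T (b i) = lam i • b i := by
  let V : ℝ → Submodule ℝ H := fun c => Module.End.eigenspace (T : H →ₗ[ℝ] H) c
  have hV : OrthogonalFamily ℝ (fun c => V c) fun c => (V c).subtypeₗᵢ :=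
    hsymm.orthogonalFamily_eigenspaces
  have hmem : ∀ c x, x ∈ V c ↔ T x = c • x := fun c x => Module.End.mem_eigenspace_iff
  have hcl : ∀ c, IsClosed (V c : Set H) := fun c => by
    have : (V c : Set H) = {x | T x = c • x} := by ext x; exact hmem c x
    rw [this]
    exact isClosed_eq T.continuous (continuous_const_smul c)
  have : ∀ c, CompleteSpace (V c) := fun c => (hcl c).completeSpace_coe
  choose w w_basis hw using fun c => exists_hilbertBasis ℝ (V c)
  let v : (Σ c, w c) → H := fun i => (w_basis i.1 i.2 : V i.1)
  have hv : Orthonormal ℝ v :=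
    hV.orthonormal_sigma_orthonormal fun c => (w_basis c).orthonormal
  have hbot : (Submodule.span ℝ (range v))ᗮ = ⊥ := by
    rw [eq_bot_iff, ← ContinuousLinearMap.orthogonalComplement_iSup_eigenspaces_eq_bot hT hsymm,
      ← Submodule.iInf_orthogonal]
    refine fun x hx => (Submodule.mem_iInf _).2 fun c y hy => ?_
    have h1 := ((innerSL ℝ x).comp (V c).subtypeL).hasSum ((w_basis c).hasSum_repr ⟨y, hy⟩)
    have h2 : (fun i => (innerSL ℝ x).comp (V c).subtypeL
        ((w_basis c).repr ⟨y, hy⟩ i • w_basis c i)) = fun _ => 0 := by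
      funext i
      have h3 : inner ℝ x (w_basis c i : H) = 0 := by
        rw [real_inner_comm]
        exact hx _ (Submodule.subset_span ⟨⟨c, i⟩, rfl⟩)
      simp [h3]
    rw [h2] at h1
    rw [real_inner_comm]
    exact h1.unique hasSum_zero
  refine ⟨Σ c, w c, HilbertBasis.mkOfOrthogonalEqBot hv hbot, fun i => i.1, fun i => ?_⟩
  rw [HilbertBasis.coe_mkOfOrthogonalEqBot]
  exact (hmem _ _).1 (w_basis i.1 i.2).2

/-- A positive family that tends to zero on an infinite index set can be listed in nonincreasing
order. -/
theorem exists_equiv_nat_antitone [Infinite ι] (w : ι → ℝ) (hpos : ∀ i, 0 < w i)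
    (hw : Tendsto w cofinite (𝓝 0)) : ∃ σ : ℕ ≃ ι, Antitone (w ∘ σ) := by
  classical
  have hfin : ∀ i, {j | w i ≤ w j}.Finite := fun i => by
    have := hw.eventually_lt_const (hpos i)
    simpa [Filter.eventually_cofinite] using this
  have hpick : ∀ s : Finset ι, ∃ i, i ∉ s ∧ ∀ j, j ∉ s → w j ≤ w i := by
    intro s
    obtain ⟨i, hi⟩ := Infinite.exists_notMem_finset s
    obtain ⟨k, hk, hmax⟩ := ((hfin i).toFinset \ s).exists_max_image w ⟨i, by simp [hi]⟩
    simp only [Finset.mem_sdiff, Finite.mem_toFinset, mem_ofPred_eq] at hk hmax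
    refine ⟨k, hk.2, fun j hj => ?_⟩
    by_cases hij : w i ≤ w j
    · exact hmax j ⟨hij, hj⟩
    · exact (not_le.1 hij).le.trans hk.1
  choose pick hnot hmax using hpick
  -- `S n` holds the `n` indices listed first; each step adds a maximizer among the remaining ones
  let S : ℕ → Finset ι := fun n => n.rec ∅ fun _ s => insert (pick s) s
  have hS : Monotone S := monotone_nat_of_le_succ fun n => Finset.subset_insert _ _
  have hmem : ∀ m n, m < n → pick (S m) ∈ S n := fun m n hmn =>
    hS (Nat.succ_le_of_lt hmn) (Finset.mem_insert_self _ _)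
  have hinj : Function.Injective fun n => pick (S n) := by
    intro m n h
    by_contra hne
    rcases lt_or_gt_of_ne hne with hmn | hmn
    · exact hnot (S n) (by simpa only [← h] using hmem m n hmn)
    · exact hnot (S m) (by simpa only [h] using hmem n m hmn)
  have hrange : ∀ n i, i ∈ S n → ∃ m, pick (S m) = i := by
    intro n
    induction n with
    | zero => intro i hi; exact absurd hi (Finset.notMem_empty i)
    | succ n ih =>
      intro i hi
      rcases Finset.mem_insert.1 hi with h | h
      · exact ⟨n, h.symm⟩
      · exact ih i h
  have hsurj : Function.Surjective fun n => pick (S n) := by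
    intro i
    by_contra hi
    refine Set.infinite_range_of_injective hinj ((hfin i).subset ?_)
    rintro _ ⟨n, rfl⟩
    exact hmax (S n) i fun h => hi (hrange n i h)
  refine ⟨Equiv.ofBijective _ ⟨hinj, hsurj⟩, fun m n hmn => ?_⟩
  exact hmax (S m) _ fun h => hnot (S n) (hS hmn h)

/-- An orthonormal basis of eigenvectors with square-summable eigenvalues can be listed as a
sequence in which no eigenvalue is larger in modulus than a nonzero one before it. -/
theorem HilbertBasis.exists_eigensystem_sorted [TopologicalSpace.SeparableSpace H] [CompleteSpace H]
    [Infinite ι] (b : HilbertBasis ι ℝ H) (T : H →L[ℝ] H) (c : ι → ℝ)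
    (hb : ∀ i, T (b i) = c i • b i) (hc : Summable fun i => c i ^ 2) :
    ∃ (lam : ℕ → ℝ) (e : HilbertBasis ℕ ℝ H), FTransform.IsEigensystem T lam e ∧
      ∀ m n, m ≤ n → lam m ≠ 0 → |lam n| ≤ |lam m| := by
  have := b.orthonormal.countable_index
  obtain ⟨k, hk⟩ := exists_injective_nat ι
  -- the vanishing eigenvalues get small positive weights: with infinitely many of them and
  -- infinitely many nonzero ones, both kinds have to alternate in the sequence
  let w : ι → ℝ := fun i => if c i = 0 then (1 / 2) ^ k i else |c i|
  have hpos : ∀ i, 0 < w i := fun i => by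
    by_cases h : c i = 0
    · simp [w, h]
    · simp [w, h]
  have hle : ∀ i, |c i| ≤ w i := fun i => by
    by_cases h : c i = 0
    · simp [w, h]
    · simp [w, h]
  have hc0 : Tendsto (fun i => |c i|) cofinite (𝓝 0) := by
    have := hc.tendsto_cofinite_zero.sqrt
    simpa [Real.sqrt_sq_eq_abs] using this
  have hk0 : Tendsto (fun i => (1 / 2 : ℝ) ^ k i) cofinite (𝓝 0) := by
    have h1 := hk.tendsto_cofinite
    rw [Nat.cofinite_eq_atTop] at h1
    exact (tendsto_pow_atTop_nhds_zero_of_lt_one (by norm_num) (by norm_num)).comp h1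
  have hw : Tendsto w cofinite (𝓝 0) := by
    refine squeeze_zero (fun i => (hpos i).le) (fun i => ?_) (by simpa using hc0.add hk0)
    by_cases h : c i = 0
    · simp [w, h]
    · simp [w, h]
  obtain ⟨σ, hσ⟩ := exists_equiv_nat_antitone w hpos hw
  have hrange : range (b ∘ σ) = range b := σ.surjective.range_comp _
  refine ⟨c ∘ σ, HilbertBasis.mk (b.orthonormal.comp σ σ.injective)
    (by rw [hrange, b.dense_span]), fun n => ?_, fun m n hmn hm => ?_⟩
  · simp [hb]
  · calc |c (σ n)| ≤ w (σ n) := hle _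
      _ ≤ w (σ m) := hσ hmn
      _ = |c (σ m)| := if_neg hm

namespace FTransform.IsEigensystem

variable {T : H →L[ℝ] H} {lam : ℕ → ℝ} {e : HilbertBasis ℕ ℝ H}

theorem hasSum_apply (h : IsEigensystem T lam e) (f : H) :
    HasSum (fun n => (lam n * inner ℝ f (e n)) • e n) (T f) := by
  have h1 : (fun n => (lam n * inner ℝ f (e n)) • e n) = fun n => T (e.repr f n • e n) := by
    funext n
    rw [map_smul, h n, e.repr_apply_apply, real_inner_comm, smul_smul, mul_comm]
  rw [h1]
  exact T.hasSum (e.hasSum_repr f)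

theorem inner_apply (h : IsEigensystem T lam e) (f : H) (n : ℕ) :
    inner ℝ (T f) (e n) = lam n * inner ℝ f (e n) := by
  classical
  have h1 := ((innerSL ℝ (e n)).hasSum (h.hasSum_apply f)).unique <|
    hasSum_single n (f := fun m => innerSL ℝ (e n) ((lam m * inner ℝ f (e m)) • e m))
      fun m hm => by simp [e.orthonormal.2 hm.symm]
  rw [real_inner_comm]
  simpa [inner_smul_right, e.orthonormal.1 n] using h1

theorem hasSum_sq (h : IsEigensystem T lam e) (f : H) :
    HasSum (fun n => lam n ^ 2 * |inner ℝ f (e n)| ^ 2) (‖T f‖ ^ 2) := by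
  have h1 := e.hasSum_inner_mul_inner (T f) (T f)
  rw [real_inner_self_eq_norm_sq] at h1
  refine h1.congr_fun fun n => ?_
  rw [real_inner_comm (T f) (e n), h.inner_apply, sq_abs]
  ring

theorem norm_apply_sq_le (h : IsEigensystem T lam e) (hlam : Summable fun n => lam n ^ 2) (f : H) :
    ‖T f‖ ^ 2 ≤ ‖f‖ ^ 2 * ∑' n, lam n ^ 2 := by
  refine hasSum_le (fun n => ?_) (h.hasSum_sq f) (hlam.hasSum.mul_left (‖f‖ ^ 2))
  rw [mul_comm]
  refine mul_le_mul_of_nonneg_right ?_ (sq_nonneg _)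
  have := abs_real_inner_le_norm f (e n)
  rw [e.orthonormal.1 n, mul_one] at this
  exact pow_le_pow_left₀ (abs_nonneg _) this 2

end FTransform.IsEigensystem

end Hilbert

/-! ### Infinite-dimensionality of `L²` -/

theorem MeasureTheory.exists_subset_measure_lt {X : Type*} [TopologicalSpace X] [MeasurableSpace X]
    [OpensMeasurableSpace X] [SecondCountableTopology X] (μ : Measure X) [μ.OuterRegular]
    [NullSingletonClass μ] {B : Set X} (hBm : MeasurableSet B) (hB : μ B ≠ 0) {ε : ENNReal}
    (hε : ε ≠ 0) :
    ∃ A ⊆ B, MeasurableSet A ∧ 0 < μ A ∧ μ A < ε := by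
  obtain ⟨x, -, hx⟩ := exists_mem_forall_mem_nhdsWithin_pos_measure hB
  obtain ⟨U, hxU, hU, hUε⟩ := Set.exists_isOpen_lt_of_lt (μ := μ) {x} ε
    (by rw [measure_singleton]; exact pos_iff_ne_zero.2 hε)
  exact ⟨B ∩ U, inter_subset_left, hBm.inter hU.measurableSet,
    hx _ (inter_mem self_mem_nhdsWithin (mem_nhdsWithin_of_mem_nhds
      (hU.mem_nhds (hxU rfl)))), (measure_mono inter_subset_right).trans_lt hUε⟩

/-- The space `L²(μ)` of a nonzero atomless measure is infinite-dimensional. On some set `B` of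
positive measure the members of a finite orthonormal basis would all be bounded by some `M`, and
expanding the indicator function of `A ⊆ B` would give `μ A ≤ N * (M * μ A) ^ 2`, with `N` the size
of the basis; this fails when `μ A` is small. -/
theorem HilbertBasis.infinite_of_nullSingletonClass {X ι : Type*} [TopologicalSpace X]
    [MeasurableSpace X] [OpensMeasurableSpace X] [SecondCountableTopology X] (μ : Measure X)
    [μ.OuterRegular] [IsFiniteMeasure μ] [NullSingletonClass μ] (hμ : μ ≠ 0)
    (b : HilbertBasis ι ℝ (Lp ℝ 2 μ)) :
    Infinite ι := by
  by_contra hfin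
  rw [not_infinite_iff_finite] at hfin
  have := Fintype.ofFinite ι
  let g : X → ℝ := fun x => ∑ i, ‖b i x‖
  have hgm : Measurable g := Finset.measurable_sum _ fun i _ =>
    (Lp.stronglyMeasurable (b i)).measurable.norm
  obtain ⟨M, hM⟩ : ∃ M : ℕ, 0 < μ {x | g x ≤ M} := by
    refine exists_measure_pos_of_not_measure_iUnion_null fun h => hμ ?_
    rw [← Measure.measure_univ_eq_zero, ← h]
    congr 1
    refine (eq_univ_of_forall fun x => ?_).symm
    obtain ⟨n, hn⟩ := exists_nat_ge (g x)
    exact mem_iUnion.2 ⟨n, hn⟩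
  -- below this measure, `μ A ≤ N * (M * μ A) ^ 2` fails for `N = Fintype.card ι`
  set ε : ℝ := ((Fintype.card ι : ℝ) * (M : ℝ) ^ 2 + 1)⁻¹ with hε
  have hε0 : 0 < ε := by positivity
  obtain ⟨A, hAB, hAm, hA0, hAε⟩ := exists_subset_measure_lt μ
    (measurableSet_le hgm measurable_const) hM.ne' (ε := ENNReal.ofReal ε) (by simpa using hε0)
  have hAtop : μ A ≠ ⊤ := measure_ne_top μ A
  set a : ℝ := μ.real A with ha
  have ha0 : 0 < a := ENNReal.toReal_pos hA0.ne' hAtop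
  have haε : a < ε := (ENNReal.lt_ofReal_iff_toReal_lt hAtop).1 hAε
  set f : Lp ℝ 2 μ := indicatorConstLp 2 hAm hAtop (1 : ℝ) with hf
  have hinner : ∀ i, inner ℝ f (b i) ^ 2 ≤ ((M : ℝ) * a) ^ 2 := fun i => by
    have h1 : inner ℝ f (b i) = ∫ x in A, b i x ∂μ := by
      rw [hf, L2.inner_indicatorConstLp_one]
    rw [h1, ← sq_abs]
    refine pow_le_pow_left₀ (abs_nonneg _) ?_ 2
    refine norm_setIntegral_le_of_norm_le_const (f := fun x => b i x) hAtop.lt_top fun x hx => ?_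
    exact (Finset.single_le_sum (f := fun i => ‖b i x‖) (fun j _ => norm_nonneg _)
      (Finset.mem_univ i)).trans (hAB hx)
  have hnorm : ‖f‖ ^ 2 = a := by
    rw [← real_inner_self_eq_norm_sq, hf, L2.inner_indicatorConstLp_one,
      setIntegral_congr_ae (g := fun _ => (1 : ℝ)) hAm]
    · simp [ha]
    · filter_upwards [indicatorConstLp_coeFn (p := 2) (hs := hAm) (hμs := hAtop) (c := (1 : ℝ))]
        with x hx hxA
      rw [hx, indicator_of_mem hxA]
  have hpars : ‖f‖ ^ 2 = ∑ i, inner ℝ f (b i) ^ 2 := by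
    have h1 := b.tsum_inner_mul_inner f f
    rw [real_inner_self_eq_norm_sq, tsum_fintype] at h1
    rw [← h1]
    exact Finset.sum_congr rfl fun i _ => by rw [real_inner_comm f (b i), sq]
  have hle : a ≤ Fintype.card ι * ((M : ℝ) * a) ^ 2 := by
    calc a = _ := hnorm.symm.trans hpars
      _ ≤ _ := by simpa using Finset.sum_le_card_nsmul Finset.univ _ _ fun i _ => hinner i
  have h2 : 1 ≤ (Fintype.card ι * (M : ℝ) ^ 2) * a := by
    by_contra h
    nlinarith
  have h3 : (Fintype.card ι * (M : ℝ) ^ 2 + 1) * a < 1 := by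
    rw [mul_comm, ← lt_div_iff₀ (by positivity), one_div]
    exact haε
  linarith

namespace FTransform

variable {d : ℕ} {Ω : Set (EuclideanSpace ℝ (Fin d))}
  {K : EuclideanSpace ℝ (Fin d) → EuclideanSpace ℝ (Fin d) → ℝ}

/-! ### The integral operator as a Hilbert–Schmidt operator -/

theorem memLp_section (hΩ : IsCompact Ω)
    (hK : ContinuousOn (fun z : EuclideanSpace ℝ (Fin d) × EuclideanSpace ℝ (Fin d) => K z.1 z.2)
      (Ω ×ˢ Ω)) {p : EuclideanSpace ℝ (Fin d)} (hp : p ∈ Ω) : MemLp (K p) 2 (mu Ω) := by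
  have := isFiniteMeasure_mu hΩ
  obtain ⟨C, -, hC⟩ := exists_bound hΩ hK
  refine MemLp.of_bound (aestronglyMeasurable_section hΩ hK hp) C ?_
  filter_upwards [ae_restrict_mem hΩ.measurableSet] with q hq using hC p hp q hq

theorem transform_eq_inner (hΩ : IsCompact Ω)
    (hK : ContinuousOn (fun z : EuclideanSpace ℝ (Fin d) × EuclideanSpace ℝ (Fin d) => K z.1 z.2)
      (Ω ×ˢ Ω)) {p : EuclideanSpace ℝ (Fin d)} (hp : p ∈ Ω) (f : L2 Ω) :
    transform Ω K f p = inner ℝ ((memLp_section hΩ hK hp).toLp (K p)) f := by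
  rw [L2.inner_def, transform]
  refine integral_congr_ae ?_
  filter_upwards [(memLp_section hΩ hK hp).coeFn_toLp] with q hq
  rw [hq, real_inner_eq_re_inner, RCLike.inner_apply]
  simp [mul_comm]

theorem norm_section_sq (hΩ : IsCompact Ω)
    (hK : ContinuousOn (fun z : EuclideanSpace ℝ (Fin d) × EuclideanSpace ℝ (Fin d) => K z.1 z.2)
      (Ω ×ˢ Ω)) {p : EuclideanSpace ℝ (Fin d)} (hp : p ∈ Ω) :
    ‖(memLp_section hΩ hK hp).toLp (K p)‖ ^ 2 = ∫ q in Ω, K p q ^ 2 := by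
  rw [← real_inner_self_eq_norm_sq, ← transform_eq_inner hΩ hK hp, transform]
  refine integral_congr_ae ?_
  filter_upwards [(memLp_section hΩ hK hp).coeFn_toLp] with q hq
  rw [hq, sq]

theorem aestronglyMeasurable_kernel (hΩ : IsCompact Ω)
    (hK : ContinuousOn (fun z : EuclideanSpace ℝ (Fin d) × EuclideanSpace ℝ (Fin d) => K z.1 z.2)
      (Ω ×ˢ Ω)) :
    AEStronglyMeasurable (fun z : EuclideanSpace ℝ (Fin d) × EuclideanSpace ℝ (Fin d) => K z.1 z.2)
      ((mu Ω).prod (mu Ω)) := by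
  rw [Measure.prod_restrict]
  exact hK.aestronglyMeasurable (hΩ.measurableSet.prod hΩ.measurableSet)

theorem ae_prod_mem (hΩ : IsCompact Ω) :
    ∀ᵐ z ∂((mu Ω).prod (mu Ω)), z ∈ Ω ×ˢ Ω := by
  rw [Measure.prod_restrict]
  exact ae_restrict_mem (hΩ.measurableSet.prod hΩ.measurableSet)

theorem integrable_integral_section_sq (hΩ : IsCompact Ω)
    (hK : ContinuousOn (fun z : EuclideanSpace ℝ (Fin d) × EuclideanSpace ℝ (Fin d) => K z.1 z.2)
      (Ω ×ˢ Ω)) : Integrable (fun p => ∫ q in Ω, K p q ^ 2) (mu Ω) := by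
  have := isFiniteMeasure_mu hΩ
  obtain ⟨C, -, hC⟩ := exists_bound hΩ hK
  have h1 : Integrable (fun z : EuclideanSpace ℝ (Fin d) × EuclideanSpace ℝ (Fin d) =>
      K z.1 z.2 ^ 2) ((mu Ω).prod (mu Ω)) := by
    refine Integrable.of_bound ((aestronglyMeasurable_kernel hΩ hK).pow 2) (C ^ 2) ?_
    filter_upwards [ae_prod_mem hΩ] with z hz
    rw [norm_pow]
    exact pow_le_pow_left₀ (norm_nonneg _) (hC _ hz.1 _ hz.2) 2
  exact h1.integral_prod_left

theorem norm_integralOperator_sq (hΩ : IsCompact Ω)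
    (hK : ContinuousOn (fun z : EuclideanSpace ℝ (Fin d) × EuclideanSpace ℝ (Fin d) => K z.1 z.2)
      (Ω ×ˢ Ω)) (f : L2 Ω) :
    ‖integralOperator hΩ hK f‖ ^ 2 = ∫ p in Ω, transform Ω K f p ^ 2 := by
  rw [← real_inner_self_eq_norm_sq, L2.inner_def]
  refine integral_congr_ae ?_
  filter_upwards [integralOperator_ae hΩ hK f] with p hp
  rw [hp]
  simp [transform, sq]

/-- The squared norms `‖L_K (b i)‖ ^ 2` add up to the energy: by Parseval's identity for each
section `K p`, the functions `(L_K (b i)) p ^ 2` add up to `∫ K p q ^ 2 dq`. -/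
theorem hasSum_norm_integralOperator_sq {ι : Type*} [Countable ι] (hΩ : IsCompact Ω)
    (hK : ContinuousOn (fun z : EuclideanSpace ℝ (Fin d) × EuclideanSpace ℝ (Fin d) => K z.1 z.2)
      (Ω ×ˢ Ω)) (b : HilbertBasis ι ℝ (L2 Ω)) :
    HasSum (fun i => ‖integralOperator hΩ hK (b i)‖ ^ 2) (energy Ω K) := by
  have hpars : ∀ p ∈ Ω, HasSum (fun i => transform Ω K (b i) p ^ 2) (∫ q in Ω, K p q ^ 2) := by
    intro p hp
    have h1 := b.hasSum_inner_mul_inner ((memLp_section hΩ hK hp).toLp (K p))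
      ((memLp_section hΩ hK hp).toLp (K p))
    rw [real_inner_self_eq_norm_sq, norm_section_sq hΩ hK hp] at h1
    refine h1.congr_fun fun i => ?_
    rw [real_inner_comm _ (b i), ← transform_eq_inner hΩ hK hp, sq]
  simp_rw [norm_integralOperator_sq]
  refine hasSum_integral_of_dominated_convergence (fun i p => transform Ω K (b i) p ^ 2)
    (fun i => (memLp_transform hΩ hK (b i)).1.pow 2) (fun i => ?_) ?_ ?_ ?_
  · exact ae_of_all _ fun p => by rw [Real.norm_of_nonneg (sq_nonneg _)]
  · filter_upwards [ae_restrict_mem hΩ.measurableSet] with p hp using (hpars p hp).summable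
  · refine (integrable_integral_section_sq hΩ hK).congr ?_
    filter_upwards [ae_restrict_mem hΩ.measurableSet] with p hp using (hpars p hp).tsum_eq.symm
  · filter_upwards [ae_restrict_mem hΩ.measurableSet] with p hp using hpars p hp

theorem isSymmetric_integralOperator (hΩ : IsCompact Ω)
    (hK : ContinuousOn (fun z : EuclideanSpace ℝ (Fin d) × EuclideanSpace ℝ (Fin d) => K z.1 z.2)
      (Ω ×ˢ Ω)) (hsymm : ∀ p ∈ Ω, ∀ q ∈ Ω, K p q = K q p) :
    (integralOperator hΩ hK : L2 Ω →ₗ[ℝ] L2 Ω).IsSymmetric := by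
  have := isFiniteMeasure_mu hΩ
  have key : ∀ f g : L2 Ω, inner ℝ (integralOperator hΩ hK f) g
      = ∫ p in Ω, ∫ q in Ω, K p q * f q * g p := by
    intro f g
    rw [L2.inner_def]
    refine integral_congr_ae ?_
    filter_upwards [integralOperator_ae hΩ hK f] with p hp
    rw [hp, integral_mul_const]
    simp [mul_comm]
  intro f g
  change inner ℝ (integralOperator hΩ hK f) g = inner ℝ f (integralOperator hΩ hK g)
  rw [real_inner_comm _ f, key f g, key g f]
  obtain ⟨C, -, hC⟩ := exists_bound hΩ hK
  rw [integral_integral_swap]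
  · refine setIntegral_congr_fun hΩ.measurableSet fun q hq => ?_
    refine setIntegral_congr_fun hΩ.measurableSet fun p hp => ?_
    simp only [hsymm p hp q hq]
    ring
  · have h1 : Integrable (fun z : EuclideanSpace ℝ (Fin d) × EuclideanSpace ℝ (Fin d) =>
        g z.1 * f z.2) ((mu Ω).prod (mu Ω)) :=
      (integrable_of_L2 hΩ g).mul_prod (integrable_of_L2 hΩ f)
    refine (h1.bdd_mul (c := C) (aestronglyMeasurable_kernel hΩ hK) ?_).congr
      (ae_of_all _ fun z => by simp only [Function.uncurry]; ring)
    filter_upwards [ae_prod_mem hΩ] with z hz using hC _ hz.1 _ hz.2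

theorem exists_eigensystem_sorted (hd : 0 < d) (hΩ : IsCompact Ω) (hvol : 0 < volume Ω)
    (hK : ContinuousOn (fun z : EuclideanSpace ℝ (Fin d) × EuclideanSpace ℝ (Fin d) => K z.1 z.2)
      (Ω ×ˢ Ω)) (hsymm : ∀ p ∈ Ω, ∀ q ∈ Ω, K p q = K q p) :
    ∃ (lam : ℕ → ℝ) (e : HilbertBasis ℕ ℝ (L2 Ω)),
      IsEigensystem (integralOperator hΩ hK) lam e ∧
      ∀ m n, m ≤ n → lam m ≠ 0 → |lam n| ≤ |lam m| := by
  have := isFiniteMeasure_mu hΩ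
  -- positive dimension, so that points are null sets
  have : NeZero d := ⟨hd.ne'⟩
  have : Fact ((2 : ENNReal) ≠ ⊤) := ⟨by norm_num⟩
  obtain ⟨s, b₀, -⟩ := exists_hilbertBasis ℝ (L2 Ω)
  have := b₀.orthonormal.countable_index
  have hcomp : IsCompactOperator (integralOperator hΩ hK) :=
    b₀.isCompactOperator_of_summable _ (hasSum_norm_integralOperator_sq hΩ hK b₀).summable
  obtain ⟨κ, b, c, hb⟩ :=
    hcomp.exists_hilbertBasis_eigenvectors (isSymmetric_integralOperator hΩ hK hsymm)
  have := b.orthonormal.countable_index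
  have : Infinite κ := b.infinite_of_nullSingletonClass (mu Ω) (by simpa [mu] using hvol.ne')
  refine b.exists_eigensystem_sorted _ c hb ?_
  refine (hasSum_norm_integralOperator_sq hΩ hK b).summable.congr fun i => ?_
  rw [hb, norm_smul, b.orthonormal.1, mul_one, Real.norm_eq_abs, sq_abs]

theorem IsEigensystem.hasSum_eigenvalue_sq (hΩ : IsCompact Ω)
    (hK : ContinuousOn (fun z : EuclideanSpace ℝ (Fin d) × EuclideanSpace ℝ (Fin d) => K z.1 z.2)
      (Ω ×ˢ Ω)) {lam : ℕ → ℝ} {e : HilbertBasis ℕ ℝ (L2 Ω)}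
    (h : IsEigensystem (integralOperator hΩ hK) lam e) :
    HasSum (fun n => lam n ^ 2) (energy Ω K) := by
  refine (hasSum_norm_integralOperator_sq hΩ hK e).congr_fun fun n => ?_
  rw [h n, norm_smul, e.orthonormal.1, mul_one, Real.norm_eq_abs, sq_abs]

end FTransform

namespace FTransform

variable {d : ℕ} {Ω : Set (EuclideanSpace ℝ (Fin d))}
  {K : EuclideanSpace ℝ (Fin d) → EuclideanSpace ℝ (Fin d) → ℝ}
  {lam : ℕ → ℝ} {e : HilbertBasis ℕ ℝ (L2 Ω)}

/-! ### Representatives of the eigenfunctions and the expansion of the kernel in `L²` -/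

/-- The representative of the `n`-th member `e n` of an eigensystem given by the eigenvalue
equation, `p ↦ (lam n)⁻¹ * ∫_Ω K(p,q) e n (q) dq`; where `lam n = 0`, just some representative. -/
noncomputable def eigenfunction {d : ℕ} {Ω : Set (EuclideanSpace ℝ (Fin d))}
    (K : EuclideanSpace ℝ (Fin d) → EuclideanSpace ℝ (Fin d) → ℝ) (lam : ℕ → ℝ)
    (e : HilbertBasis ℕ ℝ (L2 Ω)) (n : ℕ) (p : EuclideanSpace ℝ (Fin d)) : ℝ :=
  if lam n = 0 then e n p else (lam n)⁻¹ * transform Ω K (e n) p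

theorem eigenfunction_of_ne_zero {n : ℕ} (hn : lam n ≠ 0) :
    eigenfunction K lam e n = fun p => (lam n)⁻¹ * transform Ω K (e n) p := by
  funext p
  exact if_neg hn

theorem mul_eigenfunction {n : ℕ} (hn : lam n ≠ 0) (p : EuclideanSpace ℝ (Fin d)) :
    lam n * eigenfunction K lam e n p = transform Ω K (e n) p := by
  rw [eigenfunction_of_ne_zero hn, mul_inv_cancel_left₀ hn]

theorem IsEigensystem.transform_ae {hΩ : IsCompact Ω}
    {hK : ContinuousOn (fun z : EuclideanSpace ℝ (Fin d) × EuclideanSpace ℝ (Fin d) => K z.1 z.2)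
      (Ω ×ˢ Ω)} (h : IsEigensystem (integralOperator hΩ hK) lam e) (n : ℕ) :
    transform Ω K (e n) =ᵐ[mu Ω] fun p => lam n * e n p := by
  have h1 := integralOperator_ae hΩ hK (e n)
  rw [h n] at h1
  filter_upwards [h1, Lp.coeFn_smul (lam n) (e n)] with p hp1 hp2
  rw [transform, ← hp1, hp2, Pi.smul_apply, smul_eq_mul]

theorem IsEigensystem.eigenfunction_ae {hΩ : IsCompact Ω}
    {hK : ContinuousOn (fun z : EuclideanSpace ℝ (Fin d) × EuclideanSpace ℝ (Fin d) => K z.1 z.2)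
      (Ω ×ˢ Ω)} (h : IsEigensystem (integralOperator hΩ hK) lam e) (n : ℕ) :
    e n =ᵐ[mu Ω] eigenfunction K lam e n := by
  by_cases hn : lam n = 0
  · exact ae_of_all _ fun p => (if_pos hn).symm
  · filter_upwards [h.transform_ae n] with p hp
    simp only [eigenfunction_of_ne_zero hn, hp, inv_mul_cancel_left₀ hn]

theorem continuousOn_eigenfunction (hΩ : IsCompact Ω)
    (hK : ContinuousOn (fun z : EuclideanSpace ℝ (Fin d) × EuclideanSpace ℝ (Fin d) => K z.1 z.2)
      (Ω ×ˢ Ω)) {n : ℕ} (hn : lam n ≠ 0) : ContinuousOn (eigenfunction K lam e n) Ω := by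
  rw [eigenfunction_of_ne_zero hn]
  exact continuousOn_const.mul (continuousOn_transform hΩ hK (e n))

theorem IsEigensystem.eigenfunction_eq {hΩ : IsCompact Ω}
    {hK : ContinuousOn (fun z : EuclideanSpace ℝ (Fin d) × EuclideanSpace ℝ (Fin d) => K z.1 z.2)
      (Ω ×ˢ Ω)} (h : IsEigensystem (integralOperator hΩ hK) lam e) {n : ℕ} (hn : lam n ≠ 0)
    (p : EuclideanSpace ℝ (Fin d)) :
    eigenfunction K lam e n p = (lam n)⁻¹ * ∫ q in Ω, K p q * eigenfunction K lam e n q := by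
  rw [← mul_right_inj' hn, mul_eigenfunction hn, mul_inv_cancel_left₀ hn]
  refine integral_congr_ae ?_
  filter_upwards [h.eigenfunction_ae n] with q hq
  rw [hq]

theorem _root_.Orthonormal.norm_sub_sum_inner_sq {ι H : Type*} [NormedAddCommGroup H]
    [InnerProductSpace ℝ H] {v : ι → H} (hv : Orthonormal ℝ v) (s : Finset ι) (x : H) :
    ‖x - ∑ n ∈ s, inner ℝ x (v n) • v n‖ ^ 2 = ‖x‖ ^ 2 - ∑ n ∈ s, inner ℝ x (v n) ^ 2 := by
  rw [norm_sub_sq_real, inner_sum]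
  have h1 : ‖∑ n ∈ s, inner ℝ x (v n) • v n‖ ^ 2 = ∑ n ∈ s, inner ℝ x (v n) ^ 2 := by
    rw [← real_inner_self_eq_norm_sq, hv.inner_sum]
    exact Finset.sum_congr rfl fun n _ => by simp [sq]
  have h2 : ∑ n ∈ s, inner ℝ x (inner ℝ x (v n) • v n) = ∑ n ∈ s, inner ℝ x (v n) ^ 2 :=
    Finset.sum_congr rfl fun n _ => by rw [inner_smul_right, sq]
  rw [h1, h2]
  ring

/-- The squared `L²`-distance between a section of the kernel and a partial sum of its expansion,
by Bessel's identity: the coefficients of `K p` are the numbers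
`(L_K (e n)) p`. The second part excludes a truncation in `ENNReal.ofReal`. -/
theorem IsEigensystem.lintegral_section_sub_sum {hΩ : IsCompact Ω}
    {hK : ContinuousOn (fun z : EuclideanSpace ℝ (Fin d) × EuclideanSpace ℝ (Fin d) => K z.1 z.2)
      (Ω ×ˢ Ω)} (h : IsEigensystem (integralOperator hΩ hK) lam e) (s : Finset ℕ) :
    ∀ᵐ p ∂(mu Ω), ∫⁻ q in Ω, ‖K p q - ∑ n ∈ s, lam n * eigenfunction K lam e n p *
        eigenfunction K lam e n q‖ₑ ^ (2 : ℝ) =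
      ENNReal.ofReal ((∫ q in Ω, K p q ^ 2) - ∑ n ∈ s, transform Ω K (e n) p ^ 2) ∧
      0 ≤ (∫ q in Ω, K p q ^ 2) - ∑ n ∈ s, transform Ω K (e n) p ^ 2 := by
  have hae := ae_all_iff.2 h.transform_ae
  have hφ := ae_all_iff.2 h.eigenfunction_ae
  filter_upwards [ae_restrict_mem hΩ.measurableSet, hae, hφ] with p hp hp1 hp2
  set k : L2 Ω := (memLp_section hΩ hK hp).toLp (K p) with hk
  have h1 := e.orthonormal.norm_sub_sum_inner_sq s k
  have hcoef : ∀ n, inner ℝ k (e n) = transform Ω K (e n) p := fun n =>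
    (transform_eq_inner hΩ hK hp (e n)).symm
  simp only [hcoef] at h1
  rw [norm_section_sq hΩ hK hp] at h1
  rw [← h1]
  refine ⟨?_, sq_nonneg _⟩
  have h2 : ∀ x : L2 Ω, ENNReal.ofReal (‖x‖ ^ 2) = ∫⁻ q in Ω, ‖x q‖ₑ ^ (2 : ℝ) := by
    intro x
    rw [ENNReal.ofReal_pow (norm_nonneg _), ofReal_norm, Lp.enorm_def,
      ← ENNReal.rpow_natCast, eLpNorm_eq_lintegral_rpow_enorm_toReal (by norm_num) (by norm_num),
      ← ENNReal.rpow_mul]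
    simp
  rw [h2]
  refine lintegral_congr_ae ?_
  have h3 : (∑ n ∈ s, transform Ω K (e n) p • e n : L2 Ω) =ᵐ[mu Ω]
      fun q => ∑ n ∈ s, transform Ω K (e n) p * e n q := by
    refine (Lp.coeFn_fun_finsetSum s _).trans ?_
    have h4 := ae_all_iff.2 fun n => Lp.coeFn_smul (transform Ω K (e n) p) (e n)
    filter_upwards [h4] with q hq
    exact Finset.sum_congr rfl fun n _ => hq n
  filter_upwards [Lp.coeFn_sub k (∑ n ∈ s, transform Ω K (e n) p • e n), h3, hφ,
    (memLp_section hΩ hK hp).coeFn_toLp] with q hq1 hq3 hq4 hq5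
  rw [hq1, Pi.sub_apply, hq3, hq5]
  congr 3
  refine Finset.sum_congr rfl fun n _ => ?_
  rw [hp1 n, ← hp2 n, hq4 n]

theorem IsEigensystem.eLpNorm_kernel_sub_sum {hΩ : IsCompact Ω}
    {hK : ContinuousOn (fun z : EuclideanSpace ℝ (Fin d) × EuclideanSpace ℝ (Fin d) => K z.1 z.2)
      (Ω ×ˢ Ω)} (h : IsEigensystem (integralOperator hΩ hK) lam e) (s : Finset ℕ) :
    eLpNorm (fun z : EuclideanSpace ℝ (Fin d) × EuclideanSpace ℝ (Fin d) =>
        K z.1 z.2 - ∑ n ∈ s, lam n * eigenfunction K lam e n z.1 * eigenfunction K lam e n z.2) 2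
        ((mu Ω).prod (mu Ω)) =
      ENNReal.ofReal (energy Ω K - ∑ n ∈ s, lam n ^ 2) ^ (1 / 2 : ℝ) := by
  have := isFiniteMeasure_mu hΩ
  have hφm : ∀ n, AEStronglyMeasurable (eigenfunction K lam e n) (mu Ω) := fun n =>
    (Lp.aestronglyMeasurable (e n)).congr (h.eigenfunction_ae n)
  have hm : AEStronglyMeasurable (fun z : EuclideanSpace ℝ (Fin d) × EuclideanSpace ℝ (Fin d) =>
      K z.1 z.2 - ∑ n ∈ s, lam n * eigenfunction K lam e n z.1 * eigenfunction K lam e n z.2)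
      ((mu Ω).prod (mu Ω)) := by
    refine (aestronglyMeasurable_kernel hΩ hK).sub ?_
    refine Finset.aestronglyMeasurable_fun_sum _ fun n _ => ?_
    exact ((hφm n).comp_fst.const_mul (lam n)).mul (hφm n).comp_snd
  have hint : ∀ n, Integrable (fun p => transform Ω K (e n) p ^ 2) (mu Ω) := fun n =>
    (memLp_transform hΩ hK (e n)).integrable_sq
  have hsect := h.lintegral_section_sub_sum s
  rw [eLpNorm_eq_lintegral_rpow_enorm_toReal (by norm_num) (by norm_num)]
  congr 1
  simp only [ENNReal.toReal_ofNat]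
  rw [lintegral_prod _ (hm.enorm.pow_const _), lintegral_congr_ae (hsect.mono fun p hp => hp.1),
    ← ofReal_integral_eq_lintegral_ofReal _ (hsect.mono fun p hp => hp.2)]
  · congr 1
    rw [integral_sub (integrable_integral_section_sq hΩ hK)
      (integrable_finsetSum _ fun n _ => hint n), integral_finsetSum _ fun n _ => hint n]
    congr 1
    refine Finset.sum_congr rfl fun n _ => ?_
    rw [← norm_integralOperator_sq hΩ hK, h n, norm_smul, e.orthonormal.1, mul_one,
      Real.norm_eq_abs, sq_abs]
  · exact (integrable_integral_section_sq hΩ hK).sub (integrable_finsetSum _ fun n _ => hint n)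

theorem IsEigensystem.tendsto_eLpNorm_kernel_sub_sum {hΩ : IsCompact Ω}
    {hK : ContinuousOn (fun z : EuclideanSpace ℝ (Fin d) × EuclideanSpace ℝ (Fin d) => K z.1 z.2)
      (Ω ×ˢ Ω)} (h : IsEigensystem (integralOperator hΩ hK) lam e) :
    Tendsto (fun s : Finset ℕ =>
      eLpNorm (fun z : EuclideanSpace ℝ (Fin d) × EuclideanSpace ℝ (Fin d) =>
        K z.1 z.2 - ∑ n ∈ s, lam n * eigenfunction K lam e n z.1 * eigenfunction K lam e n z.2) 2
        ((mu Ω).prod (mu Ω))) atTop (𝓝 0) := by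
  simp_rw [h.eLpNorm_kernel_sub_sum]
  have h1 : Tendsto (fun s : Finset ℕ => energy Ω K - ∑ n ∈ s, lam n ^ 2) atTop (𝓝 0) := by
    simpa using (tendsto_const_nhds (x := energy Ω K)).sub
      (show Tendsto (fun s : Finset ℕ => ∑ n ∈ s, lam n ^ 2) atTop _ from
        h.hasSum_eigenvalue_sq hΩ hK)
  have h2 := (ENNReal.tendsto_ofReal h1).ennrpow_const (1 / 2 : ℝ)
  simpa using h2

end FTransform

namespace FTransform

variable {d : ℕ} {Ω : Set (EuclideanSpace ℝ (Fin d))}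
  {K : EuclideanSpace ℝ (Fin d) → EuclideanSpace ℝ (Fin d) → ℝ}
  {lam : ℕ → ℝ} {e : HilbertBasis ℕ ℝ (L2 Ω)}

/-! ### Uniform convergence for positive semidefinite kernels -/

/-- A positive semidefinite kernel has a feature map into a Hilbert space, with total range: the
kernel functions of its reproducing kernel Hilbert space. -/
theorem IsPosSemidefKernel.exists_featureMap (hpos : IsPosSemidefKernel Ω K)
    (hsymm : ∀ p ∈ Ω, ∀ q ∈ Ω, K p q = K q p) :
    ∃ (H : Type) (_ : NormedAddCommGroup H) (_ : InnerProductSpace ℝ H) (_ : CompleteSpace H)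
      (g : EuclideanSpace ℝ (Fin d) → H), (∀ p ∈ Ω, ∀ q ∈ Ω, inner ℝ (g p) (g q) = K p q) ∧
      ∀ w : H, (∀ p ∈ Ω, inner ℝ (g p) w = 0) → w = 0 := by
  classical
  let M : Matrix Ω Ω (ℝ →L[ℝ] ℝ) := fun p q => K p q • ContinuousLinearMap.id ℝ ℝ
  have hM : M.PosSemidef := by
    have htfae := (RKHS.posSemidef_tfae (K := M)).out 0 2
    refine htfae.2 ⟨?_, fun v => ?_⟩
    · ext p q
      have h1 : star (ContinuousLinearMap.id ℝ ℝ) = ContinuousLinearMap.id ℝ ℝ :=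
        star_one (ℝ →L[ℝ] ℝ)
      rw [Matrix.conjTranspose_apply]
      simp only [M, star_smul, h1, star_trivial, hsymm p p.2 q q.2]
    · let σ := v.support.equivFin.symm
      have h1 := hpos v.support.card (fun i => (σ i : Ω)) (fun i => (σ i : Ω).2) fun i => v (σ i)
      rw [σ.sum_comp fun x => ∑ j, v x * v (σ j) * K x (σ j : Ω)] at h1
      simp_rw [fun x : v.support => σ.sum_comp fun y => v x * v y * K (x : Ω) (y : Ω)] at h1
      simp_rw [fun x : Ω => Finset.sum_coe_sort v.support fun y : Ω => v x * v y * K x y] at h1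
      rw [Finset.sum_coe_sort v.support fun x : Ω => ∑ y ∈ v.support, v x * v y * K x y,
        Finset.sum_comm] at h1
      refine h1.trans_eq ?_
      simp only [Finsupp.sum, RCLike.re_to_real]
      refine Finset.sum_congr rfl fun x _ => Finset.sum_congr rfl fun y _ => ?_
      simp only [M, smul_apply, ContinuousLinearMap.id_apply, RCLike.inner_apply, smul_eq_mul,
        conj_trivial]
      ring
  have : Fact M.PosSemidef := ⟨hM⟩
  let g : Ω → RKHS.OfKernel M := fun p => RKHS.kerFun (RKHS.OfKernel M) p 1
  refine ⟨RKHS.OfKernel M, inferInstance, inferInstance, inferInstance,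
    fun p => if hp : p ∈ Ω then g ⟨p, hp⟩ else 0, fun p hp q hq => ?_, fun w hw => ?_⟩
  · simp only [hp, hq, dif_pos, g]
    rw [← RKHS.kernel_inner, RKHS.OfKernel.kernel_ofKernel]
    simp [M, hsymm p hp q hq]
  · refine RKHS.ext fun p => ?_
    have := hw p p.2
    simpa [g] using this

/-- For the feature map `g` of a positive semidefinite kernel, the vectors `v n = ∫ e n (q) g(q) dq`
satisfy `⟪v m, v n⟫ = lam m * ⟪e m, e n⟫`, and `⟪g p, v n⟫` is `lam n` times the `n`-th
eigenfunction at `p` if `lam n ≠ 0`. The first identity makes the eigenvalues nonnegative. The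
vectors `v n` are total if every nonempty relatively open subset of `Ω` has positive measure;
normalizing those with `lam n ≠ 0` then gives an orthonormal basis, and Parseval's identity for
`⟪g p, g q⟫ = K p q` in it is the expansion of the kernel. -/
theorem IsEigensystem.hasSum_kernel {hΩ : IsCompact Ω}
    {hK : ContinuousOn (fun z : EuclideanSpace ℝ (Fin d) × EuclideanSpace ℝ (Fin d) => K z.1 z.2)
      (Ω ×ˢ Ω)} (h : IsEigensystem (integralOperator hΩ hK) lam e)
    (hsymm : ∀ p ∈ Ω, ∀ q ∈ Ω, K p q = K q p) (hpos : IsPosSemidefKernel Ω K)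
    (hsupp : ∀ p ∈ Ω, ∀ r > 0, 0 < volume (Ω ∩ Metric.ball p r)) :
    (∀ n, 0 ≤ lam n) ∧ ∀ p ∈ Ω, ∀ q ∈ Ω,
      HasSum (fun n => lam n * eigenfunction K lam e n p * eigenfunction K lam e n q) (K p q) := by
  have := isFiniteMeasure_mu hΩ
  obtain ⟨H, _, _, _, g, hg, htotal⟩ := hpos.exists_featureMap hsymm
  have hgc : ContinuousOn g Ω := by
    intro p hp
    have hsq : Tendsto (fun q => ‖g q - g p‖ ^ 2) (𝓝[Ω] p) (𝓝 0) := by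
      have h1 : ∀ q ∈ Ω, ‖g q - g p‖ ^ 2 = K q q - 2 * K q p + K p p := fun q hq => by
        rw [norm_sub_sq_real, ← real_inner_self_eq_norm_sq, ← real_inner_self_eq_norm_sq,
          hg q hq q hq, hg q hq p hp, hg p hp p hp]
      have h2 : ContinuousOn (fun q => K q q - 2 * K q p + K p p) Ω := by
        have h3 : ContinuousOn (fun q => K q q) Ω :=
          hK.comp (f := fun q => (q, q)) (by fun_prop) fun q hq => ⟨hq, hq⟩
        have h4 : ContinuousOn (fun q => K q p) Ω :=
          hK.comp (f := fun q => (q, p)) (by fun_prop) fun q hq => ⟨hq, hp⟩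
        exact (h3.sub (continuousOn_const.mul h4)).add continuousOn_const
      have h5 := h2 p hp
      rw [ContinuousWithinAt, show K p p - 2 * K p p + K p p = 0 by ring] at h5
      exact h5.congr' (eventually_nhdsWithin_of_forall fun q hq => (h1 q hq).symm)
    have h6 : Tendsto (fun q => ‖g q - g p‖) (𝓝[Ω] p) (𝓝 0) := by
      simpa [Real.sqrt_sq (norm_nonneg _)] using hsq.sqrt
    exact tendsto_iff_norm_sub_tendsto_zero.2 h6
  obtain ⟨C, hC⟩ := hΩ.exists_bound_of_continuousOn hgc
  have hint : ∀ f : L2 Ω, Integrable (fun q => f q • g q) (mu Ω) := fun f => by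
    refine (integrable_of_L2 hΩ f).smul_bdd C (hgc.aestronglyMeasurable hΩ.measurableSet) ?_
    filter_upwards [ae_restrict_mem hΩ.measurableSet] with q hq using hC q hq
  let v : ℕ → H := fun n => ∫ q in Ω, e n q • g q
  have hinner : ∀ (w : H) n, inner ℝ w (v n) = ∫ q in Ω, e n q * inner ℝ w (g q) := fun w n => by
    rw [← integral_inner (hint (e n)) w]
    simp only [inner_smul_right]
  have hgv : ∀ p ∈ Ω, ∀ n, inner ℝ (g p) (v n) = transform Ω K (e n) p := fun p hp n => by
    rw [hinner, transform]
    refine setIntegral_congr_fun hΩ.measurableSet fun q hq => ?_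
    simp only [hg p hp q hq, mul_comm]
  have hvv : ∀ m n, inner ℝ (v m) (v n) = lam m * inner ℝ (e m) (e n) := fun m n => by
    have h1 : inner ℝ (lam m • e m) (e n) = lam m * inner ℝ (e m) (e n) :=
      real_inner_smul_left _ _ _
    rw [hinner, ← h1, ← h m, L2.inner_def]
    refine integral_congr_ae ?_
    filter_upwards [ae_restrict_mem hΩ.measurableSet, integralOperator_ae hΩ hK (e m)]
      with q hq hq2
    rw [real_inner_comm, hgv q hq, hq2]
    simp [transform]
  have hvn : ∀ n, ‖v n‖ ^ 2 = lam n := fun n => by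
    rw [← real_inner_self_eq_norm_sq, hvv, real_inner_self_eq_norm_sq, e.orthonormal.1]
    simp
  have hlam : ∀ n, 0 ≤ lam n := fun n => (hvn n).symm ▸ sq_nonneg _
  have hvnorm : ∀ n, ‖v n‖ = √(lam n) := fun n => by
    rw [← hvn n, Real.sqrt_sq (norm_nonneg _)]
  refine ⟨hlam, ?_⟩
  let u : {n // lam n ≠ 0} → H := fun n => (√(lam n))⁻¹ • v n
  have hsqrt : ∀ n : {n // lam n ≠ 0}, √(lam n) ≠ 0 := fun n =>
    (Real.sqrt_pos.2 (lt_of_le_of_ne (hlam n) n.2.symm)).ne'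
  have hu : Orthonormal ℝ u := by
    refine ⟨fun n => ?_, fun m n hmn => ?_⟩
    · rw [norm_smul, hvnorm, norm_inv, Real.norm_of_nonneg (Real.sqrt_nonneg _),
        inv_mul_cancel₀ (hsqrt n)]
    · simp only [u, real_inner_smul_left, real_inner_smul_right, hvv]
      rw [e.orthonormal.2 fun h => hmn (Subtype.ext h)]
      simp
  have hbot : (Submodule.span ℝ (range u))ᗮ = ⊥ := by
    refine (Submodule.eq_bot_iff _).2 fun w hw => htotal w ?_
    have hwv : ∀ n, inner ℝ w (v n) = 0 := fun n => by
      by_cases hn : lam n = 0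
      · have : v n = 0 := by rw [← norm_eq_zero, hvnorm, hn, Real.sqrt_zero]
        rw [this, inner_zero_right]
      · have h1 := hw _ (Submodule.subset_span ⟨⟨n, hn⟩, rfl⟩)
        simp only [u, real_inner_smul_left] at h1
        rw [real_inner_comm]
        exact (mul_eq_zero.1 h1).resolve_left (inv_ne_zero (hsqrt ⟨n, hn⟩))
    -- the function `q ↦ ⟪w, g q⟫` is orthogonal to all `e n`, hence vanishes almost everywhere,
    -- and being continuous it vanishes on `Ω`
    have hFc : ContinuousOn (fun q => inner ℝ w (g q)) Ω := continuousOn_const.inner hgc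
    have hFm : MemLp (fun q => inner ℝ w (g q)) 2 (mu Ω) := by
      refine MemLp.of_bound (hFc.aestronglyMeasurable hΩ.measurableSet) (‖w‖ * C) ?_
      filter_upwards [ae_restrict_mem hΩ.measurableSet] with q hq
      exact (norm_inner_le_norm _ _).trans
        (mul_le_mul_of_nonneg_left (hC q hq) (norm_nonneg _))
    have hF0 : hFm.toLp _ = 0 := by
      have h1 : ∀ n, inner ℝ (e n) (hFm.toLp _) = 0 := fun n => by
        rw [← hwv n, hinner, L2.inner_def]
        refine integral_congr_ae ?_
        filter_upwards [hFm.coeFn_toLp] with q hq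
        rw [hq]
        simp [mul_comm]
      have h2 := e.hasSum_repr (hFm.toLp _)
      simp only [e.repr_apply_apply, h1, zero_smul] at h2
      exact h2.unique hasSum_zero
    have hFae : ∀ᵐ q ∂(mu Ω), inner ℝ w (g q) = 0 := by
      have h1 := hFm.coeFn_toLp
      rw [hF0] at h1
      filter_upwards [h1, Lp.coeFn_zero ℝ 2 (mu Ω)] with q hq1 hq2
      rw [← hq1, hq2, Pi.zero_apply]
    intro p hp
    rw [real_inner_comm]
    by_contra hne
    have h1 : ∀ᶠ q in 𝓝[Ω] p, inner ℝ w (g q) ≠ 0 := (hFc p hp).eventually_ne hne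
    obtain ⟨r, hr, hball⟩ := Metric.mem_nhdsWithin_iff.1 h1
    have h2 := hsupp p hp r hr
    rw [ae_iff, Measure.restrict_apply₀' hΩ.measurableSet.nullMeasurableSet] at hFae
    have hsub : Ω ∩ Metric.ball p r ⊆ {q | ¬inner ℝ w (g q) = 0} ∩ Ω := fun q hq =>
      ⟨hball ⟨hq.2, hq.1⟩, hq.1⟩
    exact h2.ne' (measure_mono_null hsub hFae)
  let B : HilbertBasis {n // lam n ≠ 0} ℝ H := HilbertBasis.mkOfOrthogonalEqBot hu hbot
  intro p hp q hq
  have h1 := B.hasSum_inner_mul_inner (g p) (g q)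
  rw [hg p hp q hq, show (B : {n // lam n ≠ 0} → H) = u from
    HilbertBasis.coe_mkOfOrthogonalEqBot hu hbot] at h1
  have h2 : ∀ n : {n // lam n ≠ 0}, inner ℝ (g p) (u n) * inner ℝ (u n) (g q) =
      lam n * eigenfunction K lam e n p * eigenfunction K lam e n q := fun n => by
    simp only [u, real_inner_smul_left, real_inner_smul_right]
    rw [real_inner_comm (g q) (v n), hgv p hp, hgv q hq, ← mul_eigenfunction n.2,
      ← mul_eigenfunction n.2]
    have h0 := hsqrt n
    field_simp
    rw [Real.sq_sqrt (hlam n)]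
    ring
  simp only [h2] at h1
  refine (hasSum_subtype_iff_of_support_subset (s := {n | lam n ≠ 0}) ?_).1 h1
  intro n hn h0
  exact hn (by simp [h0])

/-- **Mercer's theorem.** On the diagonal the convergence is uniform by Dini's theorem; off the
diagonal the remainder is at most the mean of the two diagonal ones. -/
theorem IsEigensystem.tendstoUniformlyOn_kernel {hΩ : IsCompact Ω}
    {hK : ContinuousOn (fun z : EuclideanSpace ℝ (Fin d) × EuclideanSpace ℝ (Fin d) => K z.1 z.2)
      (Ω ×ˢ Ω)} (h : IsEigensystem (integralOperator hΩ hK) lam e)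
    (hsymm : ∀ p ∈ Ω, ∀ q ∈ Ω, K p q = K q p) (hpos : IsPosSemidefKernel Ω K)
    (hsupp : ∀ p ∈ Ω, ∀ r > 0, 0 < volume (Ω ∩ Metric.ball p r)) :
    TendstoUniformlyOn
      (fun (s : Finset ℕ) (z : EuclideanSpace ℝ (Fin d) × EuclideanSpace ℝ (Fin d)) =>
        ∑ n ∈ s, lam n * eigenfunction K lam e n z.1 * eigenfunction K lam e n z.2)
      (fun z => K z.1 z.2) atTop (Ω ×ˢ Ω) := by
  obtain ⟨hlam, hsum⟩ := h.hasSum_kernel hsymm hpos hsupp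
  set φ := eigenfunction K lam e with hφ
  have hnonneg : ∀ n p, 0 ≤ lam n * φ n p * φ n p := fun n p => by
    rw [mul_assoc]
    exact mul_nonneg (hlam n) (mul_self_nonneg _)
  have hdiag : TendstoUniformlyOn (fun (s : Finset ℕ) p => ∑ n ∈ s, lam n * φ n p * φ n p)
      (fun p => K p p) atTop Ω := by
    refine Monotone.tendstoUniformlyOn_of_forall_tendsto hΩ (fun s => ?_) (fun p _ s t hst => ?_)
      ?_ fun p hp => hsum p hp p hp
    · refine continuousOn_finsetSum _ fun n _ => ?_
      by_cases hn : lam n = 0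
      · simp only [hn, zero_mul]
        exact continuousOn_const
      · have := continuousOn_eigenfunction (e := e) hΩ hK hn
        exact (continuousOn_const.mul this).mul this
    · exact Finset.sum_le_sum_of_subset_of_nonneg hst fun n _ _ => hnonneg n p
    · exact hK.comp (f := fun q => (q, q)) (by fun_prop) fun q hq => ⟨hq, hq⟩
  rw [Metric.tendstoUniformlyOn_iff] at hdiag ⊢
  intro ε hε
  filter_upwards [hdiag ε hε] with s hs
  rintro ⟨p, q⟩ ⟨hp, hq⟩
  have hp' := (abs_lt.1 (Real.dist_eq _ _ ▸ hs p hp)).2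
  have hq' := (abs_lt.1 (Real.dist_eq _ _ ▸ hs q hq)).2
  have hmean := ((hsum p hp p hp).add (hsum q hq q hq)).mul_left (1 / 2)
  have h1 := sum_le_hasSum s (fun n _ => ?_) (hmean.sub (hsum p hp q hq))
  have h2 := sum_le_hasSum s (fun n _ => ?_) (hmean.add (hsum p hp q hq))
  · simp only [Finset.sum_sub_distrib, Finset.sum_add_distrib, ← Finset.mul_sum] at h1 h2
    rw [Real.dist_eq, abs_lt]
    constructor <;> linarith
  · have := mul_nonneg (hlam n) (sq_nonneg (φ n p + φ n q))
    linarith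
  · have := mul_nonneg (hlam n) (sq_nonneg (φ n p - φ n q))
    linarith

end FTransform

/-! ### The eigensystem of a continuous symmetric kernel -/

theorem mainTheorem5 (d : ℕ) (hd : 0 < d) (Ω : Set (EuclideanSpace ℝ (Fin d)))
    (hΩ : IsCompact Ω) (hvol : 0 < volume Ω)
    (K : EuclideanSpace ℝ (Fin d) → EuclideanSpace ℝ (Fin d) → ℝ)
    (hK : ContinuousOn
      (fun z : EuclideanSpace ℝ (Fin d) × EuclideanSpace ℝ (Fin d) => K z.1 z.2) (Ω ×ˢ Ω))
    (hsymm : ∀ p ∈ Ω, ∀ q ∈ Ω, K p q = K q p) :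
    -- an orthonormal eigensystem exists, with the nonzero eigenvalues in nonincreasing modulus
    (∃ (lam : ℕ → ℝ) (e : HilbertBasis ℕ ℝ (FTransform.L2 Ω)),
      FTransform.IsEigensystem (FTransform.integralOperator hΩ hK) lam e ∧
      ∀ m n, m ≤ n → lam m ≠ 0 → |lam n| ≤ |lam m|) ∧
    -- and every orthonormal eigensystem has the following properties
    (∀ (lam : ℕ → ℝ) (e : HilbertBasis ℕ ℝ (FTransform.L2 Ω)),
      FTransform.IsEigensystem (FTransform.integralOperator hΩ hK) lam e →
      -- the eigenfunctions, continuous where the eigenvalue is nonzero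
      (∃ φ : ℕ → EuclideanSpace ℝ (Fin d) → ℝ,
        (∀ n, e n =ᵐ[FTransform.mu Ω] φ n) ∧
        (∀ n, lam n ≠ 0 → ContinuousOn (φ n) Ω ∧
          ∀ p ∈ Ω, φ n p = (lam n)⁻¹ * ∫ q in Ω, K p q * φ n q) ∧
        -- expansion of the kernel in `L²(Ω × Ω)`
        Tendsto (fun s : Finset ℕ =>
            eLpNorm (fun z : EuclideanSpace ℝ (Fin d) × EuclideanSpace ℝ (Fin d) =>
              K z.1 z.2 - ∑ n ∈ s, lam n * φ n z.1 * φ n z.2) 2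
              ((FTransform.mu Ω).prod (FTransform.mu Ω)))
          atTop (𝓝 0) ∧
        -- uniform and unconditional expansion of a positive semidefinite kernel
        (FTransform.IsPosSemidefKernel Ω K →
          (∀ p ∈ Ω, ∀ r > 0, 0 < volume (Ω ∩ Metric.ball p r)) →
          TendstoUniformlyOn
            (fun (s : Finset ℕ) (z : EuclideanSpace ℝ (Fin d) × EuclideanSpace ℝ (Fin d)) =>
              ∑ n ∈ s, lam n * φ n z.1 * φ n z.2)
            (fun z => K z.1 z.2) atTop (Ω ×ˢ Ω))) ∧
      -- expansion of the operator in `L²(Ω)`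
      (∀ f : FTransform.L2 Ω, HasSum (fun n => (lam n * inner ℝ f (e n)) • e n)
        (FTransform.integralOperator hΩ hK f)) ∧
      (∀ f : FTransform.L2 Ω, HasSum (fun n => lam n ^ 2 * |inner ℝ f (e n)| ^ 2)
        (‖FTransform.integralOperator hΩ hK f‖ ^ 2)) ∧
      (∀ f : FTransform.L2 Ω,
        ‖FTransform.integralOperator hΩ hK f‖ ^ 2 ≤ ‖f‖ ^ 2 * ∑' n, lam n ^ 2) ∧
      -- the energy is the sum of the squared eigenvalues, and also the squared Hilbert-Schmidt norm
      HasSum (fun n => lam n ^ 2) (FTransform.energy Ω K) ∧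
      (∀ b : HilbertBasis ℕ ℝ (FTransform.L2 Ω),
        HasSum (fun i => ‖FTransform.integralOperator hΩ hK (b i)‖ ^ 2)
          (FTransform.energy Ω K))) := by
  refine ⟨FTransform.exists_eigensystem_sorted hd hΩ hvol hK hsymm, fun lam e h => ?_⟩
  have hsq := h.hasSum_eigenvalue_sq hΩ hK
  exact ⟨⟨FTransform.eigenfunction K lam e, h.eigenfunction_ae,
      fun n hn => ⟨FTransform.continuousOn_eigenfunction hΩ hK hn,
        fun p _ => h.eigenfunction_eq hn p⟩,
      h.tendsto_eLpNorm_kernel_sub_sum, h.tendstoUniformlyOn_kernel hsymm⟩,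
    h.hasSum_apply, h.hasSum_sq, h.norm_apply_sq_le hsq.summable, hsq,
    FTransform.hasSum_norm_integralOperator_sq hΩ hK⟩
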